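/- Let $\mathbb D$ be the open unit disk in $\mathbb C$, and write $\hat f(k)$ for the power series coefficients of $f\in\mathrm{Hol}(\mathbb D)$ at $0$. For a positive sequence $\alpha=(\alpha(k))_{k\ge 0}$ with $\lim_{k\to\infty}\alpha(k+1)/\alpha(k)=1$, let $H^2_\alpha$ be the Hilbert space of all $f\in\mathrm{Hol}(\mathbb D)$ with $\sum_{k}|\hat f(k)|^2\alpha(k)^2<\infty$, with inner product $\langle f,g\rangle_\alpha=\sum_k\hat f(k)\overline{\hat g(k)}\alpha(k)^2$, and let $M_{\alpha,z}$ be the operator of multiplication by $z$ on $H^2_\alpha$. The space $H^2_\alpha$ is called Möbius invariant if $f\circ\phi\in H^2_\alpha$ for all $f\in H^2_\alpha$ and all $\phi\in\mathrm{Aut}(\mathbb D)$, where $\mathrm{Aut}(\mathbb D)$ is the group of analytic bijections of $\mathbb D$ onto itself. For two such sequences $\alpha,\beta$, let $\mathrm{Mult}(H^2_\alpha,H^2_\beta)$ be the set of all $h\in\mathrm{Hol}(\mathbb D)$ such that $hf\in H^2_\beta$ for all $f\in H^2_\alpha$, let $M_{\alpha,\beta,h}\colon H^2_\alpha\to H^2_\beta$,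 $f\mapsto hf$, be the corresponding bounded operator, and let $$T_{\alpha,\beta,h}=\begin{pmatrix} M_{\alpha,z}^* & M_{\alpha,\beta,h}^*\\ 0 & M_{\beta,z}^*\end{pmatrix}\quad\text{on } H^2_\alpha\oplus H^2_\beta .$$ A bounded linear operator $T$ on a complex separable Hilbert space is called weakly homogeneous if $\sigma(T)\subseteq\overline{\mathbb D}$ and, for every $\phi\in\mathrm{Aut}(\mathbb D)$, the operator $\phi(T)$ (given by the analytic functional calculus, i.e. $\phi(T)=\sum_k\hat\phi(k)T^k$ in operator norm) is similar to $T$. **Proposition.** Let $\alpha,\beta$ be positive sequences with $\alpha(k+1)/\alpha(k)\to1$ and $\beta(k+1)/\beta(k)\to1$ such that $H^2_\alpha$ and $H^2_\beta$ are Möbius invariant and $$\lim_{k\to\infty}\frac{\alpha(k)}{k\,\beta(k)}=0 .$$ Let $h$ be a continuous function on $\overline{\mathbb D}$ whose restriction to $\mathbb D$ belongs to $\mathrm{Mult}(H^2_\alpha,H^2_\beta)$. If $T_{\alpha,\beta,h}$ is weakly homogeneous, then either $h(z)=0$ for every $z\in\overline{\mathbb D}$, or $h(z)\neq0$ for every $z\in\overline{\mathbb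 D}$. -/

import Mathlib

open Filter Topology Set

namespace WeightedHardy

noncomputable section

/-- The open unit disk, as a subset of `ℂ`. -/
abbrev disk : Set ℂ := Metric.ball 0 1

/-- The closed unit disk, as a subset of `ℂ`. -/
abbrev closedDisk : Set ℂ := Metric.closedBall 0 1

/-- The `k`-th power series coefficient of `f` at the origin. -/
def coeff (f : ℂ → ℂ) (k : ℕ) : ℂ := iteratedDeriv k f 0 / (k.factorial : ℂ)

/-- A weight sequence: positive, with ratios of consecutive terms tending to `1`. -/
structure Weight where
  /-- The underlying sequence. -/
  toFun : ℕ → ℝ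
  pos' : ∀ k, 0 < toFun k
  ratio' : Tendsto (fun k => toFun (k + 1) / toFun k) atTop (𝓝 1)

instance : CoeFun Weight (fun _ => ℕ → ℝ) := ⟨Weight.toFun⟩

/-- `f` is holomorphic on the open unit disk and `∑ |f̂(k)|² w(k)² < ∞`.
Only the values of `f` on the open unit disk matter. -/
def MemHardy (w : Weight) (f : ℂ → ℂ) : Prop :=
  DifferentiableOn ℂ f disk ∧ Summable fun k => ‖coeff f k‖ ^ 2 * w k ^ 2

/-! ### Power series on the disk -/

theorem hasSum_coeff {f : ℂ → ℂ} (hf : DifferentiableOn ℂ f disk) {z : ℂ} (hz : z ∈ disk) :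
    HasSum (fun k => coeff f k * z ^ k) (f z) := by
  have h := Complex.hasSum_taylorSeries_on_ball hf hz
  rw [show (fun k => coeff f k * z ^ k) =
    fun k : ℕ => (k.factorial : ℂ)⁻¹ • (z - 0) ^ k • iteratedDeriv k f 0 from ?_]
  · exact h
  funext k
  simp only [coeff, sub_zero, smul_eq_mul, div_eq_mul_inv]
  ring

theorem coeff_unique {f : ℂ → ℂ} {a : ℕ → ℂ} (hf : DifferentiableOn ℂ f disk)
    (h : ∀ z ∈ disk, HasSum (fun k => a k * z ^ k) (f z)) : coeff f = a := by
  have key : ∀ b : ℕ → ℂ, (∀ z ∈ disk, HasSum (fun k => b k * z ^ k) (f z)) →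
      HasFPowerSeriesAt f (FormalMultilinearSeries.ofScalars ℂ b) 0 := by
    intro b hb
    rw [hasFPowerSeriesAt_iff]
    filter_upwards [Metric.ball_mem_nhds (0 : ℂ) one_pos] with z hz
    simpa [FormalMultilinearSeries.coeff_ofScalars, mul_comm] using hb z hz
  have h1 := key a h
  have h2 := key (coeff f) fun z hz => hasSum_coeff hf hz
  funext k
  simpa [FormalMultilinearSeries.coeff_ofScalars] using
    congrArg (fun p => FormalMultilinearSeries.coeff p k) (h2.eq_formalMultilinearSeries h1)

theorem coeff_add {f g : ℂ → ℂ} (hf : DifferentiableOn ℂ f disk)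
    (hg : DifferentiableOn ℂ g disk) (k : ℕ) :
    coeff (f + g) k = coeff f k + coeff g k :=
  congrFun (coeff_unique (a := fun k => coeff f k + coeff g k) (hf.add hg) fun z hz => by
    simpa [add_mul] using (hasSum_coeff hf hz).add (hasSum_coeff hg hz)) k

theorem coeff_smul {f : ℂ → ℂ} (c : ℂ) (hf : DifferentiableOn ℂ f disk) (k : ℕ) :
    coeff (c • f) k = c * coeff f k :=
  congrFun (coeff_unique (a := fun k => c * coeff f k) (hf.const_smul c) fun z hz => by
    simpa [mul_assoc] using (hasSum_coeff hf hz).mul_left c) k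

theorem coeff_zero (k : ℕ) : coeff 0 k = 0 :=
  congrFun (coeff_unique (f := 0) (a := fun _ => 0) (differentiableOn_const 0)
    fun z _ => by simp) k

theorem summable_pow_div (w : Weight) {r : ℝ} (h0 : 0 ≤ r) (h1 : r < 1) :
    Summable fun k => r ^ k / w k := by
  rcases h0.eq_or_lt with rfl | h0
  · refine summable_of_ne_finset_zero (s := {0}) fun k hk => ?_
    simp only [Finset.mem_singleton] at hk
    simp [hk]
  refine summable_of_ratio_test_tendsto_lt_one h1
    (Eventually.of_forall fun k => (div_pos (pow_pos h0 k) (w.pos' k)).ne') ?_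
  have h : Tendsto (fun k => r * (w (k + 1) / w k)⁻¹) atTop (𝓝 r) := by
    simpa using (w.ratio'.inv₀ one_ne_zero).const_mul r
  refine h.congr fun k => ?_
  have hk := w.pos' k
  have hk1 := w.pos' (k + 1)
  rw [Real.norm_of_nonneg (div_pos (pow_pos h0 _) hk1).le,
    Real.norm_of_nonneg (div_pos (pow_pos h0 _) hk).le, pow_succ]
  field_simp

theorem memHardy_of_coeffs (w : Weight) {a : ℕ → ℂ}
    (ha : Summable fun k => ‖a k‖ ^ 2 * w k ^ 2) :
    ∃ f : ℂ → ℂ, MemHardy w f ∧ (∀ z ∉ disk, f z = 0) ∧ coeff f = a := by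
  obtain ⟨C, hC0, hC⟩ : ∃ C : ℝ, 0 ≤ C ∧ ∀ k, ‖a k‖ ≤ C / w k := by
    refine ⟨√(∑' k, ‖a k‖ ^ 2 * w k ^ 2), Real.sqrt_nonneg _, fun k => ?_⟩
    rw [le_div_iff₀ (w.pos' k)]
    refine Real.le_sqrt_of_sq_le ?_
    rw [mul_pow]
    exact ha.le_tsum k fun j _ => by positivity
  have hsum : ∀ r : ℝ, 0 ≤ r → r < 1 → Summable fun k => C / w k * r ^ k := by
    intro r h0 h1
    refine ((summable_pow_div w h0 h1).mul_left C).congr fun k => ?_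
    ring
  have hbd : ∀ r : ℝ, ∀ k, ∀ z ∈ Metric.ball (0 : ℂ) r, ‖a k * z ^ k‖ ≤ C / w k * r ^ k := by
    intro r k z hz
    rw [mem_ball_zero_iff] at hz
    rw [norm_mul, norm_pow]
    exact mul_le_mul (hC k) (pow_le_pow_left₀ (norm_nonneg _) hz.le k) (by positivity)
      (div_nonneg hC0 (w.pos' k).le)
  have hdisk : ∀ z ∈ disk, ∃ r : ℝ, 0 ≤ r ∧ r < 1 ∧ z ∈ Metric.ball (0 : ℂ) r := by
    intro z hz
    rw [mem_ball_zero_iff] at hz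
    obtain ⟨r, hr, hr1⟩ := exists_between hz
    exact ⟨r, (norm_nonneg z).trans hr.le, hr1, by simpa using hr⟩
  set F : ℂ → ℂ := fun z => ∑' k, a k * z ^ k with hF
  have hFd : DifferentiableOn ℂ F disk := by
    intro z hz
    obtain ⟨r, h0, h1, hzr⟩ := hdisk z hz
    have := Complex.differentiableOn_tsum_of_summable_norm (F := fun k z => a k * z ^ k)
      (hsum r h0 h1) (fun k => by fun_prop) Metric.isOpen_ball (hbd r)
    exact (this.differentiableAt (Metric.isOpen_ball.mem_nhds hzr)).differentiableWithinAt
  have heq : EqOn (disk.indicator F) F disk := fun z hz => indicator_of_mem hz F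
  have hfd : DifferentiableOn ℂ (disk.indicator F) disk := hFd.congr heq
  have hc : coeff (disk.indicator F) = a := by
    refine coeff_unique hfd fun z hz => ?_
    rw [heq hz]
    obtain ⟨r, h0, h1, hzr⟩ := hdisk z hz
    exact (Summable.of_norm_bounded (hsum r h0 h1) fun k => hbd r k z hzr).hasSum
  exact ⟨disk.indicator F, ⟨hfd, by simpa [hc] using ha⟩,
    fun z hz => indicator_of_notMem hz F, hc⟩

/-! ### The Hilbert space -/

theorem memℓp_coeff {w : Weight} {f : ℂ → ℂ} (hf : MemHardy w f) :
    Memℓp (fun k => coeff f k * (w k : ℂ)) 2 := by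
  refine memℓp_gen (hf.2.congr fun k => ?_)
  simp [mul_pow, sq_abs]

theorem memHardy_of_memℓp {w : Weight} {f : ℂ → ℂ} (hd : DifferentiableOn ℂ f disk)
    (hf : Memℓp (fun k => coeff f k * (w k : ℂ)) 2) : MemHardy w f := by
  refine ⟨hd, (hf.summable (by norm_num)).congr fun k => ?_⟩
  simp [mul_pow, sq_abs]

/-- The functions in the weighted Hardy space; a function on the open unit disk is represented
by its extension by `0` to `ℂ`. -/
def hardySubmodule (w : Weight) : Submodule ℂ (ℂ → ℂ) where
  carrier := {f | MemHardy w f ∧ ∀ z ∉ disk, f z = 0}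
  zero_mem' := ⟨⟨differentiableOn_const 0, by simp [coeff_zero]⟩,
    fun _ _ => rfl⟩
  add_mem' := by
    rintro f g ⟨hf, hf0⟩ ⟨hg, hg0⟩
    refine ⟨memHardy_of_memℓp (hf.1.add hg.1) ?_, fun z hz => by simp [hf0 z hz, hg0 z hz]⟩
    convert (memℓp_coeff hf).add (memℓp_coeff hg) using 1
    funext k
    simp [coeff_add hf.1 hg.1, add_mul]
  smul_mem' := by
    rintro c f ⟨hf, hf0⟩
    refine ⟨memHardy_of_memℓp (hf.1.const_smul c) ?_, fun z hz => by simp [hf0 z hz]⟩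
    convert (memℓp_coeff hf).const_smul c using 1
    funext k
    simp [coeff_smul c hf.1, mul_assoc]

/-- The weighted Hardy space of functions on the open unit disk with weight sequence `w`. -/
def HardySpace (w : Weight) : Type := hardySubmodule w

instance (w : Weight) : AddCommGroup (HardySpace w) :=
  inferInstanceAs (AddCommGroup (hardySubmodule w))

instance (w : Weight) : Module ℂ (HardySpace w) :=
  inferInstanceAs (Module ℂ (hardySubmodule w))

instance (w : Weight) : CoeFun (HardySpace w) (fun _ => ℂ → ℂ) := ⟨fun f => f.1⟩

variable {w : Weight}

theorem HardySpace.mem (f : HardySpace w) : MemHardy w f := f.2.1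

theorem HardySpace.zero_off (f : HardySpace w) {z : ℂ} (hz : z ∉ disk) : f z = 0 := f.2.2 z hz

theorem HardySpace.add_apply (f g : HardySpace w) (z : ℂ) : (f + g) z = f z + g z := rfl

theorem HardySpace.smul_apply (c : ℂ) (f : HardySpace w) (z : ℂ) : (c • f) z = c * f z := rfl

theorem HardySpace.ext {f g : HardySpace w} (h : ∀ z ∈ disk, f z = g z) : f = g := by
  refine Subtype.ext (funext fun z => ?_)
  by_cases hz : z ∈ disk
  · exact h z hz
  · exact (f.zero_off hz).trans (g.zero_off hz).symm

/-- The coefficient map `f ↦ (f̂(k) w(k))ₖ` into `ℓ²`. -/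
def toL2 (w : Weight) : HardySpace w →ₗ[ℂ] lp (fun _ : ℕ => ℂ) 2 where
  toFun f := ⟨fun k => coeff f k * (w k : ℂ), memℓp_coeff f.mem⟩
  map_add' f g := by
    ext k
    have := coeff_add f.mem.1 g.mem.1 k
    change coeff ((f : ℂ → ℂ) + (g : ℂ → ℂ)) k * (w k : ℂ) = coeff f k * w k + coeff g k * w k
    rw [this, add_mul]
  map_smul' c f := by
    ext k
    have := coeff_smul c f.mem.1 k
    change coeff (c • (f : ℂ → ℂ)) k * (w k : ℂ) = c * (coeff f k * w k)
    rw [this, mul_assoc]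

theorem toL2_apply (f : HardySpace w) (k : ℕ) : toL2 w f k = coeff f k * (w k : ℂ) := rfl

theorem toL2_injective (w : Weight) : Function.Injective (toL2 w) := by
  intro f g h
  have hc : ∀ k, coeff f k = coeff g k := by
    intro k
    have := congrArg (fun x : lp (fun _ : ℕ => ℂ) 2 => x k) h
    simp only [toL2_apply] at this
    exact mul_right_cancel₀ (by exact_mod_cast (w.pos' k).ne') this
  refine HardySpace.ext fun z hz => ?_
  have h1 := hasSum_coeff f.mem.1 hz
  simp only [hc] at h1
  exact h1.unique (hasSum_coeff g.mem.1 hz)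

theorem toL2_surjective (w : Weight) : Function.Surjective (toL2 w) := by
  intro x
  have hw : ∀ k, (w k : ℂ) ≠ 0 := fun k => by exact_mod_cast (w.pos' k).ne'
  obtain ⟨f, hf, hf0, hc⟩ := memHardy_of_coeffs w (a := fun k => x k / (w k : ℂ)) (by
    refine ((lp.memℓp x).summable (by norm_num)).congr fun k => ?_
    have := (w.pos' k).ne'
    simp only [norm_div, Complex.norm_real, Real.norm_eq_abs, div_pow, sq_abs]
    simp
    field_simp)
  refine ⟨⟨f, hf, hf0⟩, ?_⟩
  ext k
  change coeff f k * (w k : ℂ) = x k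
  rw [hc, div_mul_cancel₀ _ (hw k)]

/-- The sum `∑ conj(f̂(k)) ĝ(k) w(k)²`. As everywhere in Mathlib, the inner product is linear
in the second variable. -/
def innerSum (f g : HardySpace w) : ℂ :=
  ∑' k, (starRingEnd ℂ) (coeff f k) * coeff g k * (w k : ℂ) ^ 2

theorem innerSum_eq (f g : HardySpace w) : innerSum f g = inner ℂ (toL2 w f) (toL2 w g) := by
  rw [lp.inner_eq_tsum]
  refine tsum_congr fun k => ?_
  simp only [toL2_apply, RCLike.inner_apply, map_mul, Complex.conj_ofReal]
  ring

/-- The inner product of the weighted Hardy space. -/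
abbrev innerCore (w : Weight) : InnerProductSpace.Core ℂ (HardySpace w) where
  inner := innerSum
  conj_inner_symm f g := by
    change (starRingEnd ℂ) (innerSum g f) = innerSum f g
    rw [innerSum_eq, innerSum_eq, inner_conj_symm]
  re_inner_nonneg f := by
    rw [innerSum_eq]
    exact inner_self_nonneg
  add_left f g k := by
    change innerSum (f + g) k = innerSum f k + innerSum g k
    simp only [innerSum_eq, map_add, inner_add_left]
  smul_left f g c := by
    change innerSum (c • f) g = (starRingEnd ℂ) c * innerSum f g
    simp only [innerSum_eq, map_smul, inner_smul_left]
  definite f hf := by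
    change innerSum f f = 0 at hf
    rw [innerSum_eq, inner_self_eq_zero] at hf
    exact toL2_injective w (hf.trans (map_zero _).symm)

instance (w : Weight) : NormedAddCommGroup (HardySpace w) :=
  (innerCore w).toNormedAddCommGroup

instance (w : Weight) : InnerProductSpace ℂ (HardySpace w) :=
  InnerProductSpace.ofCore (innerCore w).toCore

theorem inner_eq_tsum (f g : HardySpace w) :
    inner ℂ f g = ∑' k, (starRingEnd ℂ) (coeff f k) * coeff g k * (w k : ℂ) ^ 2 := rfl

/-- The coefficient map as a unitary operator onto `ℓ²`. -/
def toL2Equiv (w : Weight) : HardySpace w ≃ₗᵢ[ℂ] lp (fun _ : ℕ => ℂ) 2 :=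
  LinearIsometryEquiv.ofSurjective
    (LinearMap.isometryOfInner (toL2 w) fun f g => (innerSum_eq f g).symm) (toL2_surjective w)

instance (w : Weight) : CompleteSpace (HardySpace w) :=
  (toL2Equiv w).toIsometryEquiv.completeSpace

theorem norm_coeff_le (f : HardySpace w) (k : ℕ) : ‖coeff f k‖ ≤ ‖f‖ / w k := by
  rw [le_div_iff₀ (w.pos' k)]
  have h := lp.norm_apply_le_norm (p := 2) (by norm_num) (toL2Equiv w f) k
  rw [LinearIsometryEquiv.norm_map] at h
  change ‖coeff f k * (w k : ℂ)‖ ≤ ‖f‖ at h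
  rwa [norm_mul, Complex.norm_real, Real.norm_of_nonneg (w.pos' k).le] at h

theorem norm_apply_le (f : HardySpace w) {z : ℂ} (hz : z ∈ disk) :
    ‖f z‖ ≤ ‖f‖ * ∑' k, ‖z‖ ^ k / w k := by
  have hz1 : ‖z‖ < 1 := by simpa using hz
  have hs := (summable_pow_div w (norm_nonneg z) hz1).mul_left ‖f‖
  rw [← (hasSum_coeff f.mem.1 hz).tsum_eq, ← tsum_mul_left]
  refine tsum_of_norm_bounded hs.hasSum fun k => ?_
  rw [norm_mul, norm_pow]
  calc ‖coeff f k‖ * ‖z‖ ^ k ≤ ‖f‖ / w k * ‖z‖ ^ k := by gcongr; exact norm_coeff_le f k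
    _ = ‖f‖ * (‖z‖ ^ k / w k) := by ring

theorem tendsto_apply {u : ℕ → HardySpace w} {f : HardySpace w} (h : Tendsto u atTop (𝓝 f))
    {z : ℂ} (hz : z ∈ disk) : Tendsto (fun n => u n z) atTop (𝓝 (f z)) := by
  let e : HardySpace w →ₗ[ℂ] ℂ :=
    { toFun := fun f => f z, map_add' := fun _ _ => rfl, map_smul' := fun _ _ => rfl }
  let E := e.mkContinuous (∑' k, ‖z‖ ^ k / w k) fun f => by
    rw [mul_comm]; exact norm_apply_le f hz
  exact (E.continuous.tendsto f).comp h

/-! ### Multipliers -/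

/-- The multipliers from the Hardy space of `α` to the Hardy space of `β`: holomorphic functions
`h` on the open unit disk with `h f` in the second space for each `f` in the first. -/
def Mult (α β : Weight) : Set (ℂ → ℂ) :=
  {h | DifferentiableOn ℂ h disk ∧ ∀ f, MemHardy α f → MemHardy β (h * f)}

/-- Multiplication `f ↦ h f` as a linear map. -/
def mulLin (α β : Weight) (h : ℂ → ℂ) (hh : h ∈ Mult α β) :
    HardySpace α →ₗ[ℂ] HardySpace β where
  toFun f := ⟨h * f.1, hh.2 f.1 f.mem, fun z hz => by simp [f.zero_off hz]⟩
  map_add' f g := Subtype.ext (mul_add h f.1 g.1)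
  map_smul' c f := Subtype.ext (mul_smul_comm c h f.1)

theorem mulLin_apply {α β : Weight} {h : ℂ → ℂ} (hh : h ∈ Mult α β) (f : HardySpace α) (z : ℂ) :
    mulLin α β h hh f z = h z * f z := rfl

/-- The multiplication operator `f ↦ h f`, bounded by the closed graph theorem. -/
def mulOp (α β : Weight) (h : ℂ → ℂ) (hh : h ∈ Mult α β) : HardySpace α →L[ℂ] HardySpace β :=
  ContinuousLinearMap.ofSeqClosedGraph (g := mulLin α β h hh) fun u f g hu hg => by
    refine HardySpace.ext fun z hz => ?_
    exact tendsto_nhds_unique (tendsto_apply hg hz) ((tendsto_apply hu hz).const_mul (h z))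

theorem mulOp_apply {α β : Weight} {h : ℂ → ℂ} (hh : h ∈ Mult α β) (f : HardySpace α) (z : ℂ) :
    mulOp α β h hh f z = h z * f z := rfl

/-- The coordinate function is a multiplier of each weighted Hardy space. -/
theorem id_mem_mult (w : Weight) : (fun z => z) ∈ Mult w w := by
  refine ⟨differentiableOn_id, fun f hf => ?_⟩
  have hd : DifferentiableOn ℂ ((fun z => z) * f) disk := differentiableOn_id.mul hf.1
  have hc : coeff ((fun z => z) * f) = fun k => Nat.casesOn k 0 (coeff f) := by
    refine coeff_unique hd fun z hz => ?_
    rw [← hasSum_nat_add_iff' 1]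
    simp only [Finset.range_one, Finset.sum_singleton, Pi.mul_apply]
    simpa [pow_succ, mul_assoc, mul_comm, mul_left_comm] using (hasSum_coeff hf.1 hz).mul_left z
  refine ⟨hd, ?_⟩
  rw [hc, ← summable_nat_add_iff 1]
  obtain ⟨C, hC⟩ := w.ratio'.bddAbove_range
  have hCk : ∀ k, w (k + 1) ≤ C * w k := fun k => by
    rw [← div_le_iff₀ (w.pos' k)]
    exact hC ⟨k, rfl⟩
  refine Summable.of_nonneg_of_le (fun k => by positivity) (fun k => ?_) (hf.2.mul_left (C ^ 2))
  have h2 : w (k + 1) ^ 2 ≤ (C * w k) ^ 2 :=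
    pow_le_pow_left₀ (w.pos' _).le (hCk k) 2
  calc ‖coeff f k‖ ^ 2 * w (k + 1) ^ 2 ≤ ‖coeff f k‖ ^ 2 * (C * w k) ^ 2 := by gcongr
    _ = C ^ 2 * (‖coeff f k‖ ^ 2 * w k ^ 2) := by ring

/-- The operator `M_z` of multiplication by the coordinate function. -/
def shift (w : Weight) : HardySpace w →L[ℂ] HardySpace w := mulOp w w (fun z => z) (id_mem_mult w)

/-- The operator `[[M_z^*, M_h^*], [0, M_z^*]]` on the Hilbert space direct sum of the Hardy
spaces of `α` and `β`, that is, `(f, g) ↦ (M_z^* f + M_h^* g, M_z^* g)`. -/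
def blockOp (α β : Weight) (h : ℂ → ℂ) (hh : h ∈ Mult α β) :
    WithLp 2 (HardySpace α × HardySpace β) →L[ℂ] WithLp 2 (HardySpace α × HardySpace β) :=
  let e := WithLp.prodContinuousLinearEquiv 2 ℂ (HardySpace α) (HardySpace β)
  let fst := ContinuousLinearMap.fst ℂ (HardySpace α) (HardySpace β)
  let snd := ContinuousLinearMap.snd ℂ (HardySpace α) (HardySpace β)
  e.symm.toContinuousLinearMap ∘L
    (((shift α).adjoint ∘L fst + (mulOp α β h hh).adjoint ∘L snd).prod
      ((shift β).adjoint ∘L snd)) ∘L e.toContinuousLinearMap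

theorem blockOp_apply {α β : Weight} {h : ℂ → ℂ} (hh : h ∈ Mult α β) (f : HardySpace α)
    (g : HardySpace β) :
    blockOp α β h hh (WithLp.toLp 2 (f, g)) =
      WithLp.toLp 2 ((shift α).adjoint f + (mulOp α β h hh).adjoint g, (shift β).adjoint g) :=
  rfl

/-! ### Möbius invariance and weak homogeneity -/

/-- `φ` restricts to an analytic automorphism of the open unit disk. -/
def IsDiskAut (φ : ℂ → ℂ) : Prop := DifferentiableOn ℂ φ disk ∧ BijOn φ disk disk

/-- The weighted Hardy space is closed under composition with automorphisms of the disk. -/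
def MobiusInvariant (w : Weight) : Prop :=
  ∀ φ, IsDiskAut φ → ∀ f, MemHardy w f → MemHardy w (f ∘ φ)

section Operators

variable {E : Type*} [NormedAddCommGroup E] [InnerProductSpace ℂ E]

/-- Similarity of bounded operators. -/
def Similar (S T : E →L[ℂ] E) : Prop :=
  ∃ X : E ≃L[ℂ] E, S ∘L X.toContinuousLinearMap = X.toContinuousLinearMap ∘L T

/-- `S = φ(T)` in the analytic functional calculus, for `φ` analytic on a disk of radius greater
than `1` about the origin and `T` with spectrum in the closed unit disk. In that situation
`φ(T) = ∑ φ̂(k) Tᵏ` with convergence in operator norm. Each automorphism of the unit disk extends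
analytically to such a larger disk, and its coefficients at the origin are those of the
extension. -/
def IsCalculus (φ : ℂ → ℂ) (T S : E →L[ℂ] E) : Prop :=
  HasSum (fun k => coeff φ k • T ^ k) S

/-- `T` is weakly homogeneous: its spectrum lies in the closed unit disk and `φ(T)` is similar
to `T` for each automorphism `φ` of the open unit disk. -/
def WeaklyHomogeneous (T : E →L[ℂ] E) : Prop :=
  spectrum ℂ T ⊆ closedDisk ∧
    ∀ φ, IsDiskAut φ → ∃ S : E →L[ℂ] E, IsCalculus φ T S ∧ Similar S T

end Operators

end

end WeightedHardy

namespace WeightedHardy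

noncomputable section

/-! ### Coefficients -/

/-! Passing to adjoints turns the block operator into `(f, g) ↦ (z f, h f + z g)`, on which `φ` of
the calculus acts as `(f, g) ↦ (φ f, φ' h f + φ g)`. Weak homogeneity gives, for every automorphism
`φ`, a surjective `V` intertwining these two operators; write it as a 2 × 2 matrix of operators
between Hardy spaces.

Each entry satisfies a recursion on monomials. Without an inhomogeneous term it is a weighted
composition `f ↦ u · (f ∘ φ)` (`apply_eq_of_intertwine`). An inhomogeneous term `θ` would, after
composition with `φ⁻¹`, put a part growing like `n` into the image of `zⁿ`. Boundedness and `α(k) /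
(k β(k)) → 0` exclude this, so `θ = 0` (`eq_zero_of_intertwine`). If `h` is not identically zero on
the disk, this kills the upper right entry, makes the diagonal entries weighted compositions with
symbols `r` and `q`, and yields `φ' h r = q (h ∘ φ)`. Since `1/r` and `q` are multipliers, they are
bounded, whence `|φ'| |h| ≤ C |h ∘ φ|` on the disk (`exists_bound_of_weaklyHomogeneous`).

The dichotomy follows. By transitivity of the automorphisms, one zero in the disk spreads to the
whole disk. By rotations and continuity, one zero on the circle spreads to the whole circle, and the
maximum principle then gives `h = 0`. -/

theorem isOpen_disk : IsOpen disk := Metric.isOpen_ball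

theorem coeff_congr {f g : ℂ → ℂ} (hg : DifferentiableOn ℂ g disk) (h : EqOn f g disk) :
    coeff f = coeff g :=
  coeff_unique (hg.congr h) fun z hz => by rw [h hz]; exact hasSum_coeff hg hz

theorem coeff_pow_mul {f : ℂ → ℂ} (hf : DifferentiableOn ℂ f disk) (n k : ℕ) :
    coeff (fun z => z ^ n * f z) (n + k) = coeff f k := by
  have hc : coeff (fun z => z ^ n * f z) =
      fun j => if n ≤ j then coeff f (j - n) else 0 := by
    refine coeff_unique ((differentiableOn_id.pow n).mul hf) fun z hz => ?_
    rw [← hasSum_nat_add_iff' n]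
    rw [Finset.sum_eq_zero fun j hj => by simp [not_le.2 (Finset.mem_range.1 hj)], sub_zero]
    simpa [pow_add, mul_assoc, mul_comm, mul_left_comm] using (hasSum_coeff hf hz).mul_left (z ^ n)
  simp [hc]

theorem coeff_deriv (f : ℂ → ℂ) (k : ℕ) : coeff (deriv f) k = (k + 1) * coeff f (k + 1) := by
  simp only [coeff, iteratedDeriv_succ', Nat.factorial_succ]
  have := k.factorial_ne_zero
  push_cast
  field_simp

theorem eqOn_zero_of_coeff_eq_zero {f : ℂ → ℂ} (hf : DifferentiableOn ℂ f disk)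
    (h : ∀ k, coeff f k = 0) {z : ℂ} (hz : z ∈ disk) : f z = 0 :=
  (hasSum_coeff hf hz).unique (by simp [h])

/-- Produces the factor `φ'` in the off-diagonal entry of the calculus. The exponent is truncated at
`k = 0`, where the factor `k` makes it harmless. -/
theorem hasSum_deriv {f : ℂ → ℂ} (hf : DifferentiableOn ℂ f disk) {z : ℂ} (hz : z ∈ disk) :
    HasSum (fun k : ℕ => coeff f k * (k * z ^ (k - 1))) (deriv f z) := by
  rw [← hasSum_nat_add_iff' 1]
  have h := hasSum_coeff (hf.deriv isOpen_disk) hz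
  simp only [coeff_deriv] at h
  simpa [mul_assoc, mul_comm, mul_left_comm] using h

/-! ### Elements of the Hardy space -/

theorem MemHardy.congr {w : Weight} {f g : ℂ → ℂ} (hf : MemHardy w f) (h : EqOn g f disk) :
    MemHardy w g :=
  ⟨hf.1.congr h, by rw [coeff_congr hf.1 h]; exact hf.2⟩

/-- The element of the Hardy space given by the restriction of a function to the disk. -/
def HardySpace.ofMem {w : Weight} {f : ℂ → ℂ} (hf : MemHardy w f) : HardySpace w :=
  ⟨disk.indicator f, hf.congr fun _ hz => indicator_of_mem hz f,
    fun _ hz => indicator_of_notMem hz f⟩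

theorem HardySpace.ofMem_apply {w : Weight} {f : ℂ → ℂ} (hf : MemHardy w f) {z : ℂ}
    (hz : z ∈ disk) : HardySpace.ofMem hf z = f z := indicator_of_mem hz f

/-- Point evaluation as a bounded functional. -/
def evalAt (w : Weight) {z : ℂ} (hz : z ∈ disk) : HardySpace w →L[ℂ] ℂ :=
  LinearMap.mkContinuous
    { toFun := fun f => f z, map_add' := fun _ _ => rfl, map_smul' := fun _ _ => rfl }
    (∑' k, ‖z‖ ^ k / w k) fun f => by
      rw [mul_comm]
      exact norm_apply_le f hz

theorem evalAt_apply {w : Weight} {z : ℂ} (hz : z ∈ disk) (f : HardySpace w) :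
    evalAt w hz f = f z := rfl

theorem coeff_pow (n : ℕ) : coeff (fun z => z ^ n) = Pi.single n 1 := by
  refine coeff_unique (differentiableOn_id.pow n) fun z _ => ?_
  convert hasSum_single (f := fun k => (Pi.single n (1 : ℂ) : ℕ → ℂ) k * z ^ k) n ?_ using 1
  · simp
  · intro k hk
    simp [hk]

theorem memHardy_pow (w : Weight) (n : ℕ) : MemHardy w fun z => z ^ n := by
  refine ⟨differentiableOn_id.pow n, ?_⟩
  rw [coeff_pow]
  refine summable_of_ne_finset_zero (s := {n}) fun k hk => ?_
  simp only [Finset.mem_singleton] at hk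
  simp [hk]

/-- The monomial `z ^ n` in the Hardy space. -/
def monomial (w : Weight) (n : ℕ) : HardySpace w := HardySpace.ofMem (memHardy_pow w n)

theorem monomial_apply (w : Weight) (n : ℕ) {z : ℂ} (hz : z ∈ disk) : monomial w n z = z ^ n :=
  HardySpace.ofMem_apply _ hz

theorem coeff_monomial (w : Weight) (n : ℕ) : coeff (monomial w n) = Pi.single n 1 := by
  rw [← coeff_pow]
  exact coeff_congr (differentiableOn_id.pow n) fun z hz => monomial_apply w n hz

theorem toL2Equiv_monomial (w : Weight) (n : ℕ) :
    toL2Equiv w (monomial w n) = lp.single 2 n (w n : ℂ) := by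
  ext k
  change coeff (monomial w n) k * (w k : ℂ) = _
  rw [coeff_monomial, lp.single_apply]
  rcases eq_or_ne k n with rfl | hk
  · simp
  · simp [hk]

theorem norm_monomial (w : Weight) (n : ℕ) : ‖monomial w n‖ = w n := by
  rw [← (toL2Equiv w).norm_map, toL2Equiv_monomial, lp.norm_single (by norm_num),
    Complex.norm_real, Real.norm_of_nonneg (w.pos' n).le]

theorem hasSum_monomial {w : Weight} (f : HardySpace w) :
    HasSum (fun k => coeff f k • monomial w k) f := by
  have h := (lp.hasSum_single (by norm_num) (toL2Equiv w f)).mapL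
    ((toL2Equiv w).symm.toContinuousLinearEquiv.toContinuousLinearMap)
  simp only [ContinuousLinearEquiv.coe_coe, LinearIsometryEquiv.coe_toContinuousLinearEquiv,
    LinearIsometryEquiv.symm_apply_apply] at h
  refine h.congr_fun fun k => ?_
  rw [LinearIsometryEquiv.eq_symm_apply, map_smul, toL2Equiv_monomial, ← lp.single_smul]
  rfl

/-! ### Composition operators -/

/-- The bounded operator of composition with an automorphism of the disk. -/
theorem exists_compOp {w : Weight} (hw : MobiusInvariant w) {φ : ℂ → ℂ} (hφ : IsDiskAut φ) :
    ∃ L : HardySpace w →L[ℂ] HardySpace w, ∀ f, ∀ z ∈ disk, L f z = f (φ z) := by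
  let l : HardySpace w →ₗ[ℂ] HardySpace w :=
    { toFun := fun f => HardySpace.ofMem (hw φ hφ f f.mem)
      map_add' := fun f g => HardySpace.ext fun z hz => by
        simp only [HardySpace.add_apply, HardySpace.ofMem_apply _ hz, Function.comp_apply]
      map_smul' := fun c f => HardySpace.ext fun z hz => by
        simp only [RingHom.id_apply, HardySpace.smul_apply, HardySpace.ofMem_apply _ hz,
          Function.comp_apply] }
  have hl : ∀ f, ∀ z ∈ disk, l f z = f (φ z) := fun f z hz =>
    HardySpace.ofMem_apply (hw φ hφ f f.mem) hz
  refine ⟨ContinuousLinearMap.ofSeqClosedGraph (g := l) fun u f g hu hg => ?_, hl⟩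
  refine HardySpace.ext fun z hz => ?_
  rw [hl f z hz]
  have h1 := tendsto_apply hg hz
  simp only [Function.comp_apply, hl _ z hz] at h1
  exact tendsto_nhds_unique h1 (tendsto_apply hu (hφ.2.mapsTo hz))

/-! ### Multipliers are bounded -/

/-- Each value `r z` lies in the spectrum of multiplication by `r`: everything in the range of `r z
- M` vanishes at `z`, so the constant `1` is not attained. -/
theorem exists_bound_of_mem_mult {w : Weight} {r : ℂ → ℂ} (hr : r ∈ Mult w w) :
    ∃ C, 0 < C ∧ ∀ z ∈ disk, ‖r z‖ ≤ C := by
  let M := mulOp w w r hr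
  -- The summand `1` only serves to make the bound strictly positive.
  refine ⟨‖M‖ * ‖(1 : HardySpace w →L[ℂ] HardySpace w)‖ + 1, by positivity, fun z hz => ?_⟩
  refine (spectrum.norm_le_norm_mul_of_mem (𝕜 := ℂ) ?_).trans (le_add_of_nonneg_right zero_le_one)
  rintro hu
  obtain ⟨N, hN⟩ := hu.exists_right_inv
  have h := congrArg (fun L : HardySpace w →L[ℂ] HardySpace w => L (monomial w 0) z) hN
  simp only [one_apply_eq_self, monomial_apply w 0 hz, pow_zero] at h
  have h0 : ∀ g : HardySpace w, (algebraMap ℂ (HardySpace w →L[ℂ] HardySpace w) (r z) - M) g z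
      = 0 := by
    intro g
    rw [← evalAt_apply hz, sub_apply, map_sub,
      Algebra.algebraMap_eq_smul_one, smul_apply, map_smul,
      one_apply_eq_self, evalAt_apply, evalAt_apply, mulOp_apply, smul_eq_mul, sub_self]
  exact zero_ne_one ((h0 _).symm.trans h)

/-! ### Weights -/

theorem Weight.tendsto_ratio (w : Weight) (k : ℕ) :
    Tendsto (fun n => w (n + 1) / w (n + k)) atTop (𝓝 1) := by
  have h : ∀ k, Tendsto (fun n => w (n + k) / w n) atTop (𝓝 1) := by
    intro k
    induction k with
    | zero => simp [div_self (w.pos' _).ne']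
    | succ k ih =>
      have h2 := (w.ratio'.comp (tendsto_add_atTop_nat k)).mul ih
      rw [one_mul] at h2
      refine h2.congr fun n => ?_
      have := (w.pos' (n + k)).ne'
      have := (w.pos' n).ne'
      simp only [Function.comp_apply, ← add_assoc]
      field_simp
  have h2 := (h 1).div (h k) one_ne_zero
  rw [div_one] at h2
  refine h2.congr fun n => ?_
  have := (w.pos' (n + k)).ne'
  have := (w.pos' n).ne'
  simp only [Pi.div_apply]
  field_simp

/-- The growth hypothesis for the pair `(w, w)`, needed for the entry mapping the space of `α` to
itself. -/
theorem Weight.tendsto_div_self (w : Weight) :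
    Tendsto (fun k : ℕ => w k / ((k : ℝ) * w k)) atTop (𝓝 0) := by
  refine tendsto_inv_atTop_nhds_zero_nat.congr fun k => ?_
  have := (w.pos' k).ne'
  rw [mul_comm, div_mul_cancel_left₀ this]

/-! ### Growth of `z ↦ zⁿ a(z) + n zⁿ⁻¹ b(z)` -/

/-- The coefficient of `F (n + 1)` at `n + k` is `(n + 1) b̂(k)` up to a constant, but is at most `C
α(n + 1) / β(n + k)`. Dividing by `n + 1` and letting `n → ∞` leaves `b̂(k) = 0`. -/
theorem eq_zero_of_norm_le {α β : Weight}
    (hαβ : Tendsto (fun k : ℕ => α k / ((k : ℝ) * β k)) atTop (𝓝 0)) {a b : ℂ → ℂ}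
    (ha : DifferentiableOn ℂ a disk) (hb : DifferentiableOn ℂ b disk) (F : ℕ → HardySpace β)
    {C : ℝ} (hF : ∀ n, ‖F n‖ ≤ C * α n)
    (hFz : ∀ n, ∀ z ∈ disk, F n z = z ^ n * a z + n * z ^ (n - 1) * b z)
    {z : ℂ} (hz : z ∈ disk) : b z = 0 := by
  refine eqOn_zero_of_coeff_eq_zero hb (fun k => ?_) hz
  have hza : DifferentiableOn ℂ (fun z => z * a z) disk := differentiableOn_id.mul ha
  set A := coeff (fun z => z * a z) k with hA
  -- Taking `n + 1` avoids the truncated exponent: `F (n + 1)` is `zⁿ (z a + (n + 1) b)`.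
  have hc : ∀ n : ℕ, coeff (F (n + 1)) (n + k) = A + ((n : ℂ) + 1) * coeff b k := by
    intro n
    have hd : DifferentiableOn ℂ (((fun z => z * a z) : ℂ → ℂ) + ((n : ℂ) + 1) • b) disk :=
      hza.add (hb.const_smul _)
    rw [coeff_congr (g := fun z => z ^ n * (((fun z => z * a z) : ℂ → ℂ) + ((n : ℂ) + 1) • b) z)
        ((differentiableOn_id.pow n).mul hd), coeff_pow_mul hd, coeff_add hza (hb.const_smul _),
      coeff_smul _ hb]
    intro z hz
    rw [hFz _ z hz]
    simp only [Nat.cast_add, Nat.cast_one, Nat.add_sub_cancel, Pi.add_apply, Pi.smul_apply,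
      smul_eq_mul]
    ring
  have hlim : Tendsto (fun n : ℕ => ((n : ℂ) + 1)⁻¹ * A + coeff b k) atTop (𝓝 (coeff b k)) := by
    have h1 : Tendsto (fun n : ℕ => ((n : ℂ) + 1)⁻¹) atTop (𝓝 0) := by
      simpa [one_div] using tendsto_one_div_add_atTop_nhds_zero_nat (𝕜 := ℂ)
    simpa using (h1.mul_const A).add_const (coeff b k)
  have hzero : Tendsto (fun n : ℕ => ((n : ℂ) + 1)⁻¹ * A + coeff b k) atTop (𝓝 0) := by
    have h1 := ((hαβ.comp (tendsto_add_atTop_nat 1)).mul (β.tendsto_ratio k)).const_mul C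
    rw [zero_mul, mul_zero] at h1
    refine squeeze_zero_norm (fun n => ?_) h1
    have hn : ((n : ℂ) + 1) ≠ 0 := by exact_mod_cast n.succ_ne_zero
    have hn1 : ‖(n : ℂ) + 1‖ = (n : ℝ) + 1 := by
      have := Complex.norm_natCast (n + 1)
      push_cast at this
      exact this
    have h2 : ((n : ℂ) + 1)⁻¹ * A + coeff b k = ((n : ℂ) + 1)⁻¹ * coeff (F (n + 1)) (n + k) := by
      rw [hc]
      field_simp
    rw [h2, norm_mul, norm_inv, hn1]
    have h3 := (norm_coeff_le (F (n + 1)) (n + k)).trans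
      (div_le_div_of_nonneg_right (hF (n + 1)) (β.pos' (n + k)).le)
    refine (mul_le_mul_of_nonneg_left h3 (by positivity)).trans_eq ?_
    have := (β.pos' (n + k)).ne'
    have := (β.pos' (n + 1)).ne'
    have : (n : ℝ) + 1 ≠ 0 := by positivity
    simp only [Function.comp_apply, Nat.cast_add, Nat.cast_one]
    field_simp
  exact tendsto_nhds_unique hlim hzero

/-! ### Intertwining operators -/

/-- The recursion fixes `L` on monomials, and the monomial expansion of `f` converges in norm, so
continuity of `L` does the rest. -/
theorem apply_eq_of_intertwine {α β : Weight} (L : HardySpace α →L[ℂ] HardySpace β) {φ : ℂ → ℂ}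
    (hφ : MapsTo φ disk disk)
    (hL : ∀ n, ∀ z ∈ disk, L (monomial α (n + 1)) z = φ z * L (monomial α n) z)
    (f : HardySpace α) {z : ℂ} (hz : z ∈ disk) : L f z = L (monomial α 0) z * f (φ z) := by
  have hn : ∀ n, L (monomial α n) z = L (monomial α 0) z * φ z ^ n := by
    intro n
    induction n with
    | zero => simp
    | succ n ih => rw [hL n z hz, ih]; ring
  have h1 := (hasSum_monomial f).mapL (evalAt β hz ∘L L)
  refine h1.unique ?_
  refine ((hasSum_coeff f.mem.1 (hφ hz)).mul_left (L (monomial α 0) z)).congr_fun fun k => ?_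
  rw [map_smul, ContinuousLinearMap.comp_apply, evalAt_apply, hn, smul_eq_mul]
  ring

/-- Solving the recursion gives `L zⁿ = φⁿ L 1 + n φⁿ⁻¹ θ`. Composing with `χ = φ⁻¹`, a bounded
operator by Möbius invariance, replaces `φ` by `z` and reduces to `eq_zero_of_norm_le`. -/
theorem eq_zero_of_intertwine {α β : Weight}
    (hαβ : Tendsto (fun k : ℕ => α k / ((k : ℝ) * β k)) atTop (𝓝 0)) (hβ : MobiusInvariant β)
    (L : HardySpace α →L[ℂ] HardySpace β) {φ χ θ : ℂ → ℂ}
    (hφ : IsDiskAut φ) (hχ : IsDiskAut χ) (h1 : ∀ z ∈ disk, φ (χ z) = z)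
    (h2 : ∀ z ∈ disk, χ (φ z) = z) (hθ : DifferentiableOn ℂ θ disk)
    (hL : ∀ n, ∀ z ∈ disk, L (monomial α (n + 1)) z =
      φ z * L (monomial α n) z + θ z * φ z ^ n) {z : ℂ} (hz : z ∈ disk) : θ z = 0 := by
  obtain ⟨K, hK⟩ := exists_compOp hβ hχ
  have hn : ∀ n, ∀ z ∈ disk, L (monomial α n) z =
      φ z ^ n * L (monomial α 0) z + n * φ z ^ (n - 1) * θ z := by
    intro n z hz
    induction n with
    | zero => simp
    | succ n ih =>
      rw [hL n z hz, ih]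
      rcases n with _ | n
      · simp
      · simp only [Nat.add_sub_cancel]
        push_cast
        ring
  have key := eq_zero_of_norm_le hαβ (a := L (monomial α 0) ∘ χ) (b := θ ∘ χ)
    ((L (monomial α 0)).mem.1.comp hχ.1 hχ.2.mapsTo) (hθ.comp hχ.1 hχ.2.mapsTo)
    (fun n => K (L (monomial α n))) (C := ‖K ∘L L‖)
    (fun n => by
      rw [← norm_monomial α n]
      exact (K ∘L L).le_opNorm _)
    (fun n z hz => by
      rw [hK _ z hz, hn n _ (hχ.2.mapsTo hz), h1 z hz]
      rfl) (hφ.2.mapsTo hz)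
  simpa [h2 z hz] using key

/-! ### The adjoint of the block operator -/

/-- The operator `(f, g) ↦ (z f, h f + z g)`. -/
def lowerOp (α β : Weight) (h : ℂ → ℂ) (hh : h ∈ Mult α β) :
    WithLp 2 (HardySpace α × HardySpace β) →L[ℂ] WithLp 2 (HardySpace α × HardySpace β) :=
  (WithLp.prodContinuousLinearEquiv 2 ℂ (HardySpace α) (HardySpace β)).symm.toContinuousLinearMap ∘L
    ((shift α ∘L WithLp.fstL 2 ℂ _ _).prod
      (mulOp α β h hh ∘L WithLp.fstL 2 ℂ _ _ + shift β ∘L WithLp.sndL 2 ℂ _ _))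

theorem lowerOp_apply {α β : Weight} {h : ℂ → ℂ} (hh : h ∈ Mult α β)
    (x : WithLp 2 (HardySpace α × HardySpace β)) :
    lowerOp α β h hh x =
      WithLp.toLp 2 (shift α x.fst, mulOp α β h hh x.fst + shift β x.snd) := rfl

theorem adjoint_blockOp {α β : Weight} {h : ℂ → ℂ} (hh : h ∈ Mult α β) :
    (blockOp α β h hh).adjoint = lowerOp α β h hh := by
  symm
  rw [ContinuousLinearMap.eq_adjoint_iff]
  intro x y
  have hy : blockOp α β h hh y = WithLp.toLp 2 ((shift α).adjoint y.fst +
      (mulOp α β h hh).adjoint y.snd, (shift β).adjoint y.snd) := rfl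
  rw [lowerOp_apply, hy, WithLp.prod_inner_apply, WithLp.prod_inner_apply]
  change inner ℂ (shift α x.fst) y.fst + inner ℂ (mulOp α β h hh x.fst + shift β x.snd) y.snd =
    inner ℂ x.fst ((shift α).adjoint y.fst + (mulOp α β h hh).adjoint y.snd) +
      inner ℂ x.snd ((shift β).adjoint y.snd)
  rw [inner_add_left, inner_add_right, ContinuousLinearMap.adjoint_inner_right,
    ContinuousLinearMap.adjoint_inner_right, ContinuousLinearMap.adjoint_inner_right, add_assoc]

theorem shift_apply (w : Weight) (f : HardySpace w) (z : ℂ) : shift w f z = z * f z := rfl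

theorem lowerOp_pow_apply {α β : Weight} {h : ℂ → ℂ} (hh : h ∈ Mult α β)
    (x : WithLp 2 (HardySpace α × HardySpace β)) (k : ℕ) (z : ℂ) :
    (((lowerOp α β h hh) ^ k) x).fst z = z ^ k * x.fst z ∧
      (((lowerOp α β h hh) ^ k) x).snd z =
        k * z ^ (k - 1) * (h z * x.fst z) + z ^ k * x.snd z := by
  induction k with
  | zero => simp
  | succ k ih =>
    rw [pow_succ', mul_apply_eq_comp, lowerOp_apply]
    refine ⟨?_, ?_⟩
    · change shift α _ z = _
      rw [shift_apply, ih.1]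
      ring
    · change (mulOp α β h hh _ + shift β _ : HardySpace β) z = _
      rw [HardySpace.add_apply, mulOp_apply, shift_apply, ih.1, ih.2]
      rcases k with _ | k
      · simp
      · simp only [Nat.add_sub_cancel]
        push_cast
        ring

theorem calculus_lowerOp_apply {α β : Weight} {h : ℂ → ℂ} (hh : h ∈ Mult α β) {φ : ℂ → ℂ}
    (hφ : DifferentiableOn ℂ φ disk)
    {S : WithLp 2 (HardySpace α × HardySpace β) →L[ℂ] WithLp 2 (HardySpace α × HardySpace β)}
    (hS : IsCalculus φ (lowerOp α β h hh) S) (x : WithLp 2 (HardySpace α × HardySpace β))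
    {z : ℂ} (hz : z ∈ disk) :
    (S x).fst z = φ z * x.fst z ∧
      (S x).snd z = deriv φ z * (h z * x.fst z) + φ z * x.snd z := by
  have hx := hS.mapL (ContinuousLinearMap.apply ℂ _ x)
  constructor
  · have h1 := hx.mapL (evalAt α hz ∘L WithLp.fstL 2 ℂ _ _)
    refine h1.unique (((hasSum_coeff hφ hz).mul_right (x.fst z)).congr_fun fun k => ?_)
    change coeff φ k * (((lowerOp α β h hh) ^ k) x).fst z = _
    rw [(lowerOp_pow_apply hh x k z).1, mul_assoc]
  · have h1 := hx.mapL (evalAt β hz ∘L WithLp.sndL 2 ℂ _ _)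
    refine h1.unique ((((hasSum_deriv hφ hz).mul_right (h z * x.fst z)).add
      ((hasSum_coeff hφ hz).mul_right (x.snd z))).congr_fun fun k => ?_)
    change coeff φ k * (((lowerOp α β h hh) ^ k) x).snd z = _
    rw [(lowerOp_pow_apply hh x k z).2]
    ring

/-! ### Conjugated automorphisms -/

theorem star_mem_disk {z : ℂ} : star z ∈ disk ↔ z ∈ disk := by simp

/-- Conjugating the coefficients of `φ` is what taking adjoints in the calculus requires. -/
theorem IsDiskAut.star_conj {φ : ℂ → ℂ} (hφ : IsDiskAut φ) :
    IsDiskAut fun z => star (φ (star z)) := by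
  refine ⟨fun z hz => ?_, fun z hz => ?_, fun z hz w hw hzw => ?_, fun z hz => ?_⟩
  · have h1 := (hφ.1.differentiableAt (isOpen_disk.mem_nhds (star_mem_disk.2 hz))).star_star
    rw [star_star] at h1
    exact h1.differentiableWithinAt
  · exact star_mem_disk.2 (hφ.2.mapsTo (star_mem_disk.2 hz))
  · exact star_injective (hφ.2.injOn (star_mem_disk.2 hz) (star_mem_disk.2 hw)
      (star_injective hzw))
  · obtain ⟨w, hw, hwz⟩ := hφ.2.surjOn (star_mem_disk.2 hz)
    exact ⟨star w, star_mem_disk.2 hw, by simp only [star_star, hwz]⟩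

theorem coeff_star_conj {φ : ℂ → ℂ} (hφ : IsDiskAut φ) (k : ℕ) :
    coeff (fun z => star (φ (star z))) k = star (coeff φ k) := by
  refine congrFun (coeff_unique (a := fun k => star (coeff φ k)) hφ.star_conj.1 fun z hz => ?_) k
  have h1 := (hasSum_coeff hφ.1 (star_mem_disk.2 hz)).star
  refine h1.congr_fun fun k => ?_
  simp

/-! ### Consequences of weak homogeneity -/

/-- Apply weak homogeneity to the conjugated automorphism and take adjoints in `S X = X T`; then `V`
is the adjoint of `X⁻¹`. -/
theorem exists_intertwine {E : Type*} [NormedAddCommGroup E] [InnerProductSpace ℂ E]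
    [CompleteSpace E] {T : E →L[ℂ] E} (hT : WeaklyHomogeneous T) {φ : ℂ → ℂ} (hφ : IsDiskAut φ) :
    ∃ S V : E →L[ℂ] E, IsCalculus φ T.adjoint S ∧ Function.Surjective V ∧
      V ∘L T.adjoint = S ∘L V := by
  obtain ⟨S, hS, X, hX⟩ := hT.2 _ hφ.star_conj
  refine ⟨S.adjoint, X.symm.toContinuousLinearMap.adjoint, ?_, fun y => ?_, ?_⟩
  · have h1 := hS.star
    refine h1.congr_fun fun k => ?_
    rw [coeff_star_conj hφ, star_smul, star_star, star_pow]
    rfl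
  · refine ⟨X.toContinuousLinearMap.adjoint y, ?_⟩
    rw [← ContinuousLinearMap.comp_apply, ← ContinuousLinearMap.adjoint_comp,
      ContinuousLinearEquiv.coe_comp_coe_symm, ContinuousLinearMap.adjoint_id]
    rfl
  · rw [← ContinuousLinearMap.adjoint_comp, ← ContinuousLinearMap.adjoint_comp]
    congr 1
    ext y
    have h1 := congrArg (fun L : E →L[ℂ] E => X.symm (L (X.symm y))) hX
    simpa using h1.symm

theorem exists_bound_of_weaklyHomogeneous {α β : Weight}
    (hα : MobiusInvariant α) (hβ : MobiusInvariant β)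
    (hαβ : Tendsto (fun k : ℕ => α k / ((k : ℝ) * β k)) atTop (𝓝 0))
    {h : ℂ → ℂ} (hh : h ∈ Mult α β) (hT : WeaklyHomogeneous (blockOp α β h hh))
    (h0 : ∃ z ∈ disk, h z ≠ 0) {φ χ : ℂ → ℂ} (hφ : IsDiskAut φ) (hχ : IsDiskAut χ)
    (h1 : ∀ z ∈ disk, φ (χ z) = z) (h2 : ∀ z ∈ disk, χ (φ z) = z) :
    ∃ C, ∀ z ∈ disk, ‖deriv φ z‖ * ‖h z‖ ≤ C * ‖h (φ z)‖ := by
  obtain ⟨S, V, hS, hVs, hV⟩ := exists_intertwine hT hφ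
  rw [adjoint_blockOp] at hS hV
  have hSx := fun x {z} (hz : z ∈ disk) => calculus_lowerOp_apply hh hφ.1 hS x hz
  let e := WithLp.prodContinuousLinearEquiv 2 ℂ (HardySpace α) (HardySpace β)
  let ι₁ : HardySpace α →L[ℂ] WithLp 2 (HardySpace α × HardySpace β) :=
    e.symm.toContinuousLinearMap ∘L ContinuousLinearMap.inl ℂ _ _
  let ι₂ : HardySpace β →L[ℂ] WithLp 2 (HardySpace α × HardySpace β) :=
    e.symm.toContinuousLinearMap ∘L ContinuousLinearMap.inr ℂ _ _
  let V₁₁ := WithLp.fstL 2 ℂ (HardySpace α) (HardySpace β) ∘L V ∘L ι₁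
  let V₁₂ := WithLp.fstL 2 ℂ (HardySpace α) (HardySpace β) ∘L V ∘L ι₂
  let V₂₁ := WithLp.sndL 2 ℂ (HardySpace α) (HardySpace β) ∘L V ∘L ι₁
  let V₂₂ := WithLp.sndL 2 ℂ (HardySpace α) (HardySpace β) ∘L V ∘L ι₂
  have hι₁ : ∀ f, lowerOp α β h hh (ι₁ f) = ι₁ (shift α f) + ι₂ (mulOp α β h hh f) := by
    intro f
    refine e.injective (Prod.ext ?_ ?_)
    · change shift α f = shift α f + 0
      rw [add_zero]
    · change mulOp α β h hh f + shift β 0 = 0 + mulOp α β h hh f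
      rw [map_zero, add_zero, zero_add]
  have hι₂ : ∀ f, lowerOp α β h hh (ι₂ f) = ι₂ (shift β f) := by
    intro f
    refine e.injective (Prod.ext ?_ ?_)
    · change shift α 0 = 0
      rw [map_zero]
    · change mulOp α β h hh 0 + shift β f = shift β f
      rw [map_zero, zero_add]
  have hVx : ∀ x, V (lowerOp α β h hh x) = S (V x) := fun x =>
    congrArg (fun L : _ →L[ℂ] _ => L x) hV
  have e₁₂ : ∀ f, ∀ z ∈ disk, V₁₂ (shift β f) z = φ z * V₁₂ f z := by
    intro f z hz
    have := (hSx (V (ι₂ f)) hz).1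
    rw [← hVx, hι₂] at this
    exact this
  have e₁₁ : ∀ f, ∀ z ∈ disk, V₁₁ (shift α f) z + V₁₂ (mulOp α β h hh f) z = φ z * V₁₁ f z := by
    intro f z hz
    have := (hSx (V (ι₁ f)) hz).1
    rw [← hVx, hι₁, map_add] at this
    exact this
  have e₂₂ : ∀ f, ∀ z ∈ disk, V₂₂ (shift β f) z =
      deriv φ z * (h z * V₁₂ f z) + φ z * V₂₂ f z := by
    intro f z hz
    have := (hSx (V (ι₂ f)) hz).2
    rw [← hVx, hι₂] at this
    exact this
  have e₂₁ : ∀ f, ∀ z ∈ disk, V₂₁ (shift α f) z + V₂₂ (mulOp α β h hh f) z =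
      deriv φ z * (h z * V₁₁ f z) + φ z * V₂₁ f z := by
    intro f z hz
    have := (hSx (V (ι₁ f)) hz).2
    rw [← hVx, hι₁, map_add] at this
    exact this
  have hsm : ∀ (w : Weight) n, shift w (monomial w n) = monomial w (n + 1) := by
    intro w n
    refine HardySpace.ext fun z hz => ?_
    rw [shift_apply, monomial_apply w _ hz, monomial_apply w _ hz, pow_succ']
  have c₁₂ := fun f {z} (hz : z ∈ disk) => apply_eq_of_intertwine V₁₂ hφ.2.mapsTo
    (fun n z hz => by rw [← hsm, e₁₂ _ z hz]) f hz
  set p := V₁₂ (monomial β 0) with hp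
  have hhφ : DifferentiableOn ℂ (h ∘ φ) disk := hh.1.comp hφ.1 hφ.2.mapsTo
  -- Here `V₁₁` obeys the monomial recursion with inhomogeneous term `-p (h ∘ φ)`, which must
  -- vanish.
  have hph : ∀ z ∈ disk, p z * (h ∘ φ) z = 0 := by
    intro z hz
    have := eq_zero_of_intertwine α.tendsto_div_self hα V₁₁ (θ := fun z => -(p z * (h ∘ φ) z))
      hφ hχ h1 h2 (p.mem.1.mul hhφ).neg (fun n z hz => by
        have h3 := e₁₁ (monomial α n) z hz
        rw [hsm, c₁₂ _ hz, mulOp_apply, monomial_apply α n (hφ.2.mapsTo hz)] at h3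
        rw [← h3, Function.comp_apply]
        ring) hz
    exact neg_eq_zero.1 this
  have hp0 : ∀ z ∈ disk, p z = 0 := by
    refine (AnalyticOnNhd.eq_zero_or_eq_zero_of_mul_eq_zero
      (p.mem.1.analyticOnNhd isOpen_disk) (hhφ.analyticOnNhd isOpen_disk) hph
      (convex_ball (0 : ℂ) 1).isPreconnected).resolve_right fun h3 => ?_
    obtain ⟨w, hw, hhw⟩ := h0
    refine hhw ?_
    have := h3 (χ w) (hχ.2.mapsTo hw)
    rwa [Function.comp_apply, h1 w hw] at this
  have hV₁₂ : ∀ f, ∀ z ∈ disk, V₁₂ f z = 0 := fun f z hz => by rw [c₁₂ f hz, hp0 z hz, zero_mul]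
  have c₁₁ := fun f {z} (hz : z ∈ disk) => apply_eq_of_intertwine V₁₁ hφ.2.mapsTo
    (fun n z hz => by rw [← hsm, ← e₁₁ _ z hz, hV₁₂ _ z hz, add_zero]) f hz
  have c₂₂ := fun f {z} (hz : z ∈ disk) => apply_eq_of_intertwine V₂₂ hφ.2.mapsTo
    (fun n z hz => by rw [← hsm, e₂₂ _ z hz, hV₁₂ _ z hz, mul_zero, mul_zero, zero_add]) f hz
  set r := V₁₁ (monomial α 0) with hr
  set q := V₂₂ (monomial β 0) with hq
  -- The difference of the two sides is the inhomogeneous term of `V₂₁`; this is where the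
  -- comparison of `α` with `β` enters.
  have hrel : ∀ z ∈ disk, deriv φ z * (h z * r z) = q z * h (φ z) := by
    intro z hz
    refine sub_eq_zero.1 (eq_zero_of_intertwine hαβ hβ V₂₁
      (θ := fun z => deriv φ z * (h z * r z) - q z * (h ∘ φ) z) hφ hχ h1 h2
      (((hφ.1.deriv isOpen_disk).mul (hh.1.mul r.mem.1)).sub (q.mem.1.mul hhφ))
      (fun n z hz => ?_) hz)
    have h3 := e₂₁ (monomial α n) z hz
    rw [hsm, c₂₂ _ hz, c₁₁ _ hz, mulOp_apply, monomial_apply α n (hφ.2.mapsTo hz)] at h3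
    rw [Function.comp_apply]
    linear_combination h3
  have hq_mult : (q : ℂ → ℂ) ∈ Mult β β := by
    refine ⟨q.mem.1, fun f hf => ?_⟩
    -- `q f` is the image of `f ∘ χ` under `V₂₂`.
    refine (V₂₂ (HardySpace.ofMem (hβ χ hχ f hf))).mem.congr fun z hz => ?_
    rw [c₂₂ _ hz, HardySpace.ofMem_apply _ (hφ.2.mapsTo hz), Function.comp_apply, h2 z hz]
    rfl
  -- As `V₁₂ = 0`, surjectivity of `V` passes to `V₁₁`. Hence `r` has no zeros and `f / r = g ∘ φ`
  -- stays in the space.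
  have hV₁₁s : ∀ f : HardySpace α, ∃ g : HardySpace α, ∀ z ∈ disk, r z * g (φ z) = f z := by
    intro f
    obtain ⟨x, hx⟩ := hVs (ι₁ f)
    refine ⟨x.fst, fun z hz => ?_⟩
    have h3 : x = ι₁ x.fst + ι₂ x.snd := by
      refine e.injective (Prod.ext ?_ ?_)
      · exact (add_zero _).symm
      · exact (zero_add _).symm
    have h4 : V₁₁ x.fst + V₁₂ x.snd = f := by
      have h5 : (V (ι₁ x.fst + ι₂ x.snd)).fst = f := by rw [← h3, hx]; rfl
      rw [map_add] at h5
      exact h5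
    rw [← c₁₁ _ hz, ← h4, HardySpace.add_apply, hV₁₂ _ z hz, add_zero]
  have hr0 : ∀ z ∈ disk, r z ≠ 0 := by
    intro z hz hrz
    obtain ⟨g, hg⟩ := hV₁₁s (monomial α 0)
    have := hg z hz
    rw [hrz, zero_mul, monomial_apply α 0 hz, pow_zero] at this
    exact zero_ne_one this
  have hr_mult : (fun z => (r z)⁻¹) ∈ Mult α α := by
    refine ⟨r.mem.1.inv hr0, fun f hf => ?_⟩
    obtain ⟨g, hg⟩ := hV₁₁s (HardySpace.ofMem hf)
    refine (hα φ hφ g g.mem).congr fun z hz => ?_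
    have := hg z hz
    rw [HardySpace.ofMem_apply hf hz] at this
    rw [Pi.mul_apply, ← this, inv_mul_cancel_left₀ (hr0 z hz), Function.comp_apply]
  obtain ⟨C₁, hC₁, hb₁⟩ := exists_bound_of_mem_mult hr_mult
  obtain ⟨C₂, hC₂, hb₂⟩ := exists_bound_of_mem_mult hq_mult
  refine ⟨C₁ * C₂, fun z hz => ?_⟩
  have h3 : deriv φ z * h z = (r z)⁻¹ * q z * h (φ z) := by
    have := hr0 z hz
    rw [mul_assoc, ← hrel z hz]
    field_simp
  rw [← norm_mul, h3, norm_mul, norm_mul]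
  gcongr
  · exact hb₁ z hz
  · exact hb₂ z hz

/-! ### Rotations and involutions of the disk -/

theorem isDiskAut_of_inverse {φ χ : ℂ → ℂ} (hφ : DifferentiableOn ℂ φ disk)
    (hm : MapsTo φ disk disk) (hm' : MapsTo χ disk disk)
    (h1 : ∀ z ∈ disk, φ (χ z) = z) (h2 : ∀ z ∈ disk, χ (φ z) = z) : IsDiskAut φ :=
  ⟨hφ, hm, LeftInvOn.injOn h2, fun z hz => ⟨χ z, hm' hz, h1 z hz⟩⟩

theorem isDiskAut_rotation {c : ℂ} (hc : ‖c‖ = 1) : IsDiskAut fun z => c * z := by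
  have hc0 : c ≠ 0 := by
    rintro rfl
    simp at hc
  refine isDiskAut_of_inverse (χ := fun z => c⁻¹ * z) (by fun_prop) (fun z hz => ?_)
    (fun z hz => ?_) (fun z _ => mul_inv_cancel_left₀ hc0 z)
    fun z _ => inv_mul_cancel_left₀ hc0 z
  · simpa [hc] using hz
  · simpa [hc] using hz

/-- The involutive automorphism of the disk exchanging `0` and `a`. -/
def involution (a z : ℂ) : ℂ := (a - z) / (1 - star a * z)

theorem one_sub_star_mul_ne_zero {a z : ℂ} (ha : a ∈ disk) (hz : z ∈ disk) :
    1 - star a * z ≠ 0 := by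
  rw [mem_ball_zero_iff] at ha hz
  intro h
  have h1 : ‖star a * z‖ = 1 := by rw [← sub_eq_zero.1 h, norm_one]
  rw [norm_mul, norm_star] at h1
  nlinarith [norm_nonneg a, norm_nonneg z]

theorem involution_mem_disk {a z : ℂ} (ha : a ∈ disk) (hz : z ∈ disk) :
    involution a z ∈ disk := by
  have h0 := norm_pos_iff.2 (one_sub_star_mul_ne_zero ha hz)
  rw [mem_ball_zero_iff] at ha hz ⊢
  rw [involution, norm_div, div_lt_one h0]
  refine lt_of_pow_lt_pow_left₀ 2 h0.le ?_
  have key : ‖1 - star a * z‖ ^ 2 - ‖a - z‖ ^ 2 = (1 - ‖a‖ ^ 2) * (1 - ‖z‖ ^ 2) := by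
    simp only [← Complex.normSq_eq_norm_sq, Complex.normSq_apply, Complex.sub_re, Complex.sub_im,
      Complex.mul_re, Complex.mul_im, Complex.one_re, Complex.one_im, Complex.star_def,
      Complex.conj_re, Complex.conj_im]
    ring
  have h1 : 0 < 1 - ‖a‖ ^ 2 := by nlinarith [norm_nonneg a]
  have h2 : 0 < 1 - ‖z‖ ^ 2 := by nlinarith [norm_nonneg z]
  nlinarith [mul_pos h1 h2]

theorem involution_involution {a z : ℂ} (ha : a ∈ disk) (hz : z ∈ disk) :
    involution a (involution a z) = z := by
  have h1 := one_sub_star_mul_ne_zero ha hz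
  have h2 := one_sub_star_mul_ne_zero ha (involution_mem_disk ha hz)
  have h3 := one_sub_star_mul_ne_zero ha ha
  have h4 : involution a z * (1 - star a * z) = a - z := div_mul_cancel₀ _ h1
  rw [involution, div_eq_iff h2]
  refine mul_right_cancel₀ h1 ?_
  linear_combination (-1 + z * star a) * h4

theorem isDiskAut_involution {a : ℂ} (ha : a ∈ disk) : IsDiskAut (involution a) := by
  refine isDiskAut_of_inverse (χ := involution a) ?_ (fun z hz => involution_mem_disk ha hz)
    (fun z hz => involution_mem_disk ha hz) (fun z hz => involution_involution ha hz)
    fun z hz => involution_involution ha hz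
  exact DifferentiableOn.div (by fun_prop) (by fun_prop) fun z hz => one_sub_star_mul_ne_zero ha hz

theorem deriv_ne_zero_of_leftInverse {φ χ : ℂ → ℂ} (hφ : IsDiskAut φ) (hχ : IsDiskAut χ)
    (h : ∀ z ∈ disk, χ (φ z) = z) {z : ℂ} (hz : z ∈ disk) : deriv φ z ≠ 0 := by
  intro h0
  have h1 := (hφ.1.differentiableAt (isOpen_disk.mem_nhds hz)).hasDerivAt
  have h2 := (hχ.1.differentiableAt (isOpen_disk.mem_nhds (hφ.2.mapsTo hz))).hasDerivAt
  have h3 := h2.comp z h1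
  rw [h0, mul_zero] at h3
  have h4 : χ ∘ φ =ᶠ[𝓝 z] id := by
    filter_upwards [isOpen_disk.mem_nhds hz] with w hw using h w hw
  exact zero_ne_one ((h3.congr_of_eventuallyEq h4.symm).unique (hasDerivAt_id z))

theorem closure_disk : closure disk = closedDisk := closure_ball 0 one_ne_zero

/-! ### The dichotomy -/

theorem ne_zero_of_mem_disk {α β : Weight}
    (hα : MobiusInvariant α) (hβ : MobiusInvariant β)
    (hαβ : Tendsto (fun k : ℕ => α k / ((k : ℝ) * β k)) atTop (𝓝 0))
    {h : ℂ → ℂ} (hh : h ∈ Mult α β) (hT : WeaklyHomogeneous (blockOp α β h hh))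
    (h0 : ∃ z ∈ disk, h z ≠ 0) {z : ℂ} (hz : z ∈ disk) : h z ≠ 0 := by
  have key : ∀ a ∈ disk, ∀ w ∈ disk, h (involution a w) = 0 → h w = 0 := by
    intro a ha w hw hhw
    have hinv := fun w (hw : w ∈ disk) => involution_involution ha hw
    obtain ⟨C, hC⟩ := exists_bound_of_weaklyHomogeneous hα hβ hαβ hh hT h0
      (isDiskAut_involution ha) (isDiskAut_involution ha) hinv hinv
    have h1 := hC w hw
    rw [hhw, norm_zero, mul_zero, ← norm_mul, norm_le_zero_iff] at h1
    exact (mul_eq_zero.1 h1).resolve_left (deriv_ne_zero_of_leftInverse (isDiskAut_involution ha)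
      (isDiskAut_involution ha) hinv hw)
  intro hhz
  obtain ⟨w, hw, hhw⟩ := h0
  -- A zero travels from `z` to `0` and then to `w`, as `involution z 0 = z` and `involution w w =
  -- 0`.
  have hzero : h 0 = 0 := key z hz 0 (Metric.mem_ball_self one_pos) (by simpa [involution] using hhz)
  exact hhw (key w hw w hw (by simpa [involution] using hzero))

theorem ne_zero_of_norm_eq_one {α β : Weight}
    (hα : MobiusInvariant α) (hβ : MobiusInvariant β)
    (hαβ : Tendsto (fun k : ℕ => α k / ((k : ℝ) * β k)) atTop (𝓝 0))
    {h : ℂ → ℂ} (hcont : ContinuousOn h closedDisk) (hh : h ∈ Mult α β)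
    (hT : WeaklyHomogeneous (blockOp α β h hh)) (h0 : ∃ z ∈ disk, h z ≠ 0)
    {z : ℂ} (hz : ‖z‖ = 1) : h z ≠ 0 := by
  intro hhz
  have hcirc : ∀ w : ℂ, ‖w‖ = 1 → h w = 0 := by
    intro w hw
    have hw0 : w ≠ 0 := norm_ne_zero_iff.1 (by rw [hw]; exact one_ne_zero)
    have hz0 : z ≠ 0 := norm_ne_zero_iff.1 (by rw [hz]; exact one_ne_zero)
    have hc : ‖z / w‖ = 1 := by rw [norm_div, hz, hw, div_one]
    have hc' : ‖w / z‖ = 1 := by rw [norm_div, hz, hw, div_one]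
    -- The rotation by `z / w` carries `w` to `z` and has derivative of modulus one, so the estimate
    -- passes to the closed disk by continuity.
    obtain ⟨C, hC⟩ := exists_bound_of_weaklyHomogeneous hα hβ hαβ hh hT h0
      (isDiskAut_rotation hc) (isDiskAut_rotation hc')
      (fun v _ => by field_simp) (fun v _ => by field_simp)
    have hm : MapsTo (fun v => z / w * v) closedDisk closedDisk := fun v hv => by
      rw [mem_closedBall_zero_iff] at hv ⊢
      rwa [norm_mul, hc, one_mul]
    have hle : ∀ v ∈ closedDisk, ‖h v‖ ≤ C * ‖h (z / w * v)‖ := by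
      have hl : ContinuousOn (fun v => ‖h v‖) (closure disk) := by
        rw [closure_disk]
        exact hcont.norm
      have hr : ContinuousOn (fun v => C * ‖h (z / w * v)‖) (closure disk) := by
        rw [closure_disk]
        exact continuousOn_const.mul (hcont.comp (by fun_prop) hm).norm
      intro v hv
      refine le_on_closure (fun v hv => ?_) hl hr (closure_disk.symm ▸ hv)
      have h1 := hC v hv
      have h2 : deriv (fun v => z / w * v) v = z / w := by
        simp
      rwa [h2, hc, one_mul] at h1
    have h3 := hle w (mem_closedBall_zero_iff.2 hw.le)
    rwa [div_mul_cancel₀ z hw0, hhz, norm_zero, mul_zero, norm_le_zero_iff] at h3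
  obtain ⟨w, hw, hhw⟩ := h0
  have hd : DiffContOnCl ℂ h disk := ⟨hh.1, by rwa [closure_disk]⟩
  -- Maximum principle: vanishing on the circle forces vanishing in the disk.
  refine hhw (Complex.eqOn_of_eqOn_frontier (g := 0) Metric.isBounded_ball hd
    diffContOnCl_const (fun v hv => ?_) hw)
  rw [frontier_ball 0 one_ne_zero, mem_sphere_zero_iff_norm] at hv
  exact hcirc v hv

end

end WeightedHardy

theorem mainTheorem5 (α β : WeightedHardy.Weight)
    (hα : WeightedHardy.MobiusInvariant α) (hβ : WeightedHardy.MobiusInvariant β)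
    (hαβ : Tendsto (fun k : ℕ => α k / ((k : ℝ) * β k)) atTop (𝓝 0))
    (h : ℂ → ℂ) (hcont : ContinuousOn h WeightedHardy.closedDisk)
    (hmult : h ∈ WeightedHardy.Mult α β)
    (hT : WeightedHardy.WeaklyHomogeneous (WeightedHardy.blockOp α β h hmult)) :
    (∀ z ∈ WeightedHardy.closedDisk, h z = 0) ∨ (∀ z ∈ WeightedHardy.closedDisk, h z ≠ 0) := by
  by_cases h0 : ∃ z ∈ WeightedHardy.disk, h z ≠ 0
  · right
    intro z hz
    rcases (mem_closedBall_zero_iff.1 hz).lt_or_eq with h1 | h1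
    · exact WeightedHardy.ne_zero_of_mem_disk hα hβ hαβ hmult hT h0 (mem_ball_zero_iff.2 h1)
    · exact WeightedHardy.ne_zero_of_norm_eq_one hα hβ hαβ hcont hmult hT h0 h1
  · left
    push Not at h0
    have h1 : EqOn h (fun _ => 0) WeightedHardy.closedDisk :=
      EqOn.of_subset_closure (fun z hz => h0 z hz) hcont continuousOn_const
        Metric.ball_subset_closedBall WeightedHardy.closure_disk.ge
    exact fun z hz => h1 hz
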